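/- For every integer $n\ge 2$ and every real $p>2$ there exist a connected, complete, non-compact, smooth Riemannian manifold $M=(M,g)$ of dimension $n$ without boundary and a function $v:M\to\mathbb{R}$ such that $v\in H^{2,p}(M)$ and $v\notin W^{1,p}(M)$. More precisely, $v\in L^p(M)$, the distributional Laplacian $\Delta v$ belongs to $L^p(M)$, and $v$ has a locally integrable weak gradient $\nabla v$ with $|\nabla v|\notin L^p(M)$. Here $L^p(M)$ and all integrals refer to the Riemannian volume measure $\mu$ of $(M,g)$, and $\Delta=\operatorname{div}\nabla$ is the Laplace--Beltrami operator. A locally integrable function $h$ is the distributional Laplacian of $v\in L^1_{\mathrm{loc}}(M)$ if $\int_M v\,\Delta\varphi\,d\mu=\int_M h\,\varphi\,d\mu$ for all $\varphi\in C_c^\infty(M)$; a locally integrable vector field $X$ is the weak gradient of $v$ if $\int_M g(X,Y)\,d\mu=-\int_M v\,\operatorname{div}Y\,d\mu$ for all smooth compactly supported vector fields $Y$. Finally, $H^{2,p}(M)=\{f\in L^p(M):\Delta f\in L^p(M)\}$ with $\Delta f$ in the distributional sense, and $W^{1,p}(M)$ is the space of $f\in L^p(M)$ that have a weak gradient with $|\nabla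 f|\in L^p(M)$. -/

import Mathlib

noncomputable section

namespace RiemannianSobolev

open MeasureTheory Bundle
open scoped Manifold ContDiff ENNReal

/-- The model space `ℝⁿ` with its Euclidean norm. -/
abbrev Model (n : ℕ) : Type := EuclideanSpace ℝ (Fin n)

section Coordinates

variable {n : ℕ} {M : Type*} [TopologicalSpace M] [ChartedSpace (Model n) M]
  [RiemannianBundle (fun x : M ↦ TangentSpace (𝓡 n) x)]

/-- The `i`-th coordinate vector `∂ᵢ`, at the point with coordinates `y`, of the preferred chart
around `c`. -/
def coordVector (c : M) (y : Model n) (i : Fin n) :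
    TangentSpace (𝓡 n) ((extChartAt (𝓡 n) c).symm y) :=
  mfderiv 𝓘(ℝ, Model n) (𝓡 n) (extChartAt (𝓡 n) c).symm y (EuclideanSpace.single i (1 : ℝ))

/-- The matrix `g_{ij} = g(∂ᵢ, ∂ⱼ)` of the metric in the preferred chart around `c`, as a function
of the coordinates. -/
def metricMatrix (c : M) (y : Model n) : Matrix (Fin n) (Fin n) ℝ :=
  Matrix.of fun i j ↦ inner ℝ (coordVector c y i) (coordVector c y j)

/-- The Riemannian volume density `√(det g_{ij})` in the preferred chart around `c`. -/
def volDensity (c : M) (y : Model n) : ℝ :=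
  Real.sqrt (metricMatrix c y).det

/-- The `i`-th component, in the preferred chart around `c`, of a vector field. -/
def coordComponent (Y : ∀ x : M, TangentSpace (𝓡 n) x) (c : M) (i : Fin n) (y : Model n) : ℝ :=
  let x : M := (extChartAt (𝓡 n) c).symm y
  let w : Model n := mfderiv (𝓡 n) 𝓘(ℝ, Model n) (extChartAt (𝓡 n) c) x (Y x)
  w i

/-- The divergence of a vector field:
`div Y = (det g)^{-1/2} ∑ᵢ ∂ᵢ ((det g)^{1/2} Yⁱ)`, computed at `x` in the preferred chart
around `x`. -/
def divergence (Y : ∀ x : M, TangentSpace (𝓡 n) x) (x : M) : ℝ :=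
  (volDensity x (extChartAt (𝓡 n) x x))⁻¹ *
    ∑ i : Fin n, fderiv ℝ (fun y : Model n ↦ volDensity x y * coordComponent Y x i y)
      (extChartAt (𝓡 n) x x) (EuclideanSpace.single i (1 : ℝ))

instance instFiniteDimensionalTangent (x : M) : FiniteDimensional ℝ (TangentSpace (𝓡 n) x) :=
  inferInstanceAs (FiniteDimensional ℝ (Model n))

/-- The Riemannian gradient of a differentiable function: `g(∇f, w) = df(w)`. -/
def grad (f : M → ℝ) (x : M) : TangentSpace (𝓡 n) x :=
  (InnerProductSpace.toDual ℝ (TangentSpace (𝓡 n) x)).symm (mfderiv (𝓡 n) 𝓘(ℝ, ℝ) f x)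

variable (n) in
/-- The Laplace--Beltrami operator `Δf = div ∇f`. -/
def laplacian (f : M → ℝ) (x : M) : ℝ :=
  divergence (grad (n := n) f) x

/-- A smooth vector field on `M`. -/
def IsSmoothField [IsManifold (𝓡 n) ∞ M] (Y : ∀ x : M, TangentSpace (𝓡 n) x) : Prop :=
  ContMDiff (𝓡 n) (𝓡 n).tangent ∞ (fun x ↦ (⟨x, Y x⟩ : TangentBundle (𝓡 n) M))

/-- A smooth vector field with compact support. -/
def IsTestField [IsManifold (𝓡 n) ∞ M] (Y : ∀ x : M, TangentSpace (𝓡 n) x) : Prop :=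
  IsSmoothField Y ∧ IsCompact (closure {x : M | Y x ≠ 0})

/-- An element of `C_c^∞(M)`. -/
def IsTestFunction (φ : M → ℝ) : Prop :=
  ContMDiff (𝓡 n) 𝓘(ℝ, ℝ) ∞ φ ∧ HasCompactSupport φ

variable [MeasurableSpace M]

/-- The measure `√(det g_{ij}) dy` on the domain of the preferred chart around `c`, extended by
zero to `M`. -/
def chartVolume (c : M) : Measure M :=
  (((volume : Measure (Model n)).restrict (extChartAt (𝓡 n) c).target).withDensity
    fun y ↦ ENNReal.ofReal (volDensity c y)).map (extChartAt (𝓡 n) c).symm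

variable (n M) in
/-- The Riemannian volume measure. The chart measures agree on the overlaps of their domains, so
their supremum is the measure obtained by gluing them. -/
def riemannianVolume : Measure M :=
  ⨆ c : M, chartVolume (n := n) c

/-- `h` is the distributional Laplacian of `v`. -/
def IsDistribLaplacian (v h : M → ℝ) : Prop :=
  LocallyIntegrable v (riemannianVolume n M) ∧ LocallyIntegrable h (riemannianVolume n M) ∧
    ∀ φ : M → ℝ, IsTestFunction (n := n) φ →
      ∫ x, v x * laplacian n φ x ∂(riemannianVolume n M) =
        ∫ x, h x * φ x ∂(riemannianVolume n M)

/-- The locally integrable vector field `X` is the weak gradient of `v`. Measurability of `X` is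
expressed through its pairings with test fields. -/
def IsWeakGradient [IsManifold (𝓡 n) ∞ M] (v : M → ℝ) (X : ∀ x : M, TangentSpace (𝓡 n) x) :
    Prop :=
  LocallyIntegrable v (riemannianVolume n M) ∧
    LocallyIntegrable (fun x ↦ ‖X x‖) (riemannianVolume n M) ∧
    ∀ Y : (∀ x : M, TangentSpace (𝓡 n) x), IsTestField Y →
      AEStronglyMeasurable (fun x ↦ inner ℝ (X x) (Y x)) (riemannianVolume n M) ∧
      ∫ x, inner ℝ (X x) (Y x) ∂(riemannianVolume n M) =
        -∫ x, v x * divergence Y x ∂(riemannianVolume n M)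

variable (n) in
/-- `v ∈ H^{2,p}(M)`: both `v` and its distributional Laplacian are in `L^p(M)`. -/
def MemH2 (v : M → ℝ) (p : ℝ≥0∞) : Prop :=
  MemLp v p (riemannianVolume n M) ∧
    ∃ h : M → ℝ, MemLp h p (riemannianVolume n M) ∧ IsDistribLaplacian (n := n) v h

variable (n) in
/-- `v ∈ W^{1,p}(M)`: both `v` and the norm of its weak gradient are in `L^p(M)`. -/
def MemW1 [IsManifold (𝓡 n) ∞ M] (v : M → ℝ) (p : ℝ≥0∞) : Prop :=
  MemLp v p (riemannianVolume n M) ∧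
    ∃ X : (∀ x : M, TangentSpace (𝓡 n) x), IsWeakGradient v X ∧
      MemLp (fun x ↦ ‖X x‖) p (riemannianVolume n M)

end Coordinates

end RiemannianSobolev

end

noncomputable section

namespace RiemannianSobolev

open MeasureTheory Bundle Bornology
open scoped Manifold ContDiff Topology

variable {n : ℕ}

/-! ### Bilinear forms as smooth sections over a normed space -/

section
variable {F : Type*} [NormedAddCommGroup F] [NormedSpace ℝ F]

/-! The metric is `a² (dx_{i₀}² + dx_{i₁}²) + ∑ dx_j²` on ℝⁿ with `a ≥ 1`, and `v` is a sum of
separate bumps `c k * φ (rescale k x)` centred at the points `k e_{i₀}`, where `rescale k` stretches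
the two distinguished directions by `D k`. In the `k`-th cell `a = 1 + (D k - 1) η`, so `a` is `1`
at the centre and `D k` wherever the profile `φ` is cut off.

Where `η = 1` the rescaling is an isometry onto Euclidean space, so the Laplacian of the bump is `c
k` times the rescaled Euclidean Laplacian of `φ`. Elsewhere `φ` is the coordinate `x_{i₀}` or zero.
The flux `√g gⁱⁱ ∂ᵢ v` in the directions `i₀`, `i₁` does not see `a` (conformal invariance in
dimension two), so `v` is harmonic there whatever `a` does. The Laplacian is therefore of size `c k`
in every cell (`flux_glue`, `sum_partialD_flux`). As `√g = a² ≤ (D k)²` and the stretching has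
determinant `(D k)²`, each cell contributes at most a constant times `(c k)^p` to the `p`-th powers
of both norms (`memLp_glue`).

At the centre `a = 1`, hence `|∇v| = c k * D k` on a set of volume comparable to `(D k)⁻²`. This
contributes `(c k)^p (D k)^(p-2)`, which for `p > 2` is unbounded when `D k` grows fast enough. To
exclude every weak gradient, `exists_le_of_memW1` pairs it with a test field in the centre of each
cell and applies Hölder. Completeness follows from `a ≥ 1`: Riemannian distance dominates Euclidean
distance. -/

lemma tangent_symm_eq (x y : F) (v : F) :
    (trivializationAt F (TangentSpace 𝓘(ℝ, F)) x).symm y v = v := by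
  have h := TangentBundle.symmL_model_space (𝕜 := ℝ) x y
  exact (Trivialization.symmL_apply _ (Set.mem_univ y) v).symm.trans congr($h v)

/-- The tangent trivializations of a vector space are the identity, so the section read in them is
`B` itself. -/
lemma contMDiff_bilinear_section {B : F → F →L[ℝ] F →L[ℝ] ℝ} {k : WithTop ℕ∞}
    (hB : ContDiff ℝ k B) :
    ContMDiff 𝓘(ℝ, F) (𝓘(ℝ, F).prod 𝓘(ℝ, F →L[ℝ] F →L[ℝ] ℝ)) k
      (fun x ↦ TotalSpace.mk' (F →L[ℝ] F →L[ℝ] ℝ)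
        (E := fun x : F ↦ TangentSpace 𝓘(ℝ, F) x →L[ℝ] TangentSpace 𝓘(ℝ, F) x →L[ℝ] ℝ)
        x (B x)) := by
  intro x
  refine (contMDiffAt_hom_bundle (E₁ := fun x : F ↦ TangentSpace 𝓘(ℝ, F) x)
    (E₂ := fun x : F ↦ TangentSpace 𝓘(ℝ, F) x →L[ℝ] ℝ) _).2 ⟨contMDiffAt_id, ?_⟩
  have : ContMDiffAt 𝓘(ℝ, F) 𝓘(ℝ, F →L[ℝ] F →L[ℝ] ℝ) k B x := hB.contMDiff.contMDiffAt
  refine this.congr_of_eventuallyEq (Filter.Eventually.of_forall fun y ↦ ?_)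
  refine ContinuousLinearMap.ext fun u ↦ ContinuousLinearMap.ext fun v ↦ ?_
  have := inCoordinates_apply_eq₂ (F₁ := F) (F₂ := F) (F₃ := ℝ)
    (E₁ := fun x : F ↦ TangentSpace 𝓘(ℝ, F) x)
    (E₂ := fun x : F ↦ TangentSpace 𝓘(ℝ, F) x) (E₃ := fun _ ↦ ℝ) (x₀ := x) (x := y)
    (ϕ := B y) (v := u) (w := v) (Set.mem_univ y) (Set.mem_univ y) (Set.mem_univ y)
  refine this.trans ?_
  rw [tangent_symm_eq, tangent_symm_eq]
  simp
  rfl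

lemma contDiff_smul_vector {E : Type*} [NormedAddCommGroup E] [NormedSpace ℝ E]
    {f : E → ℝ} {k : WithTop ℕ∞} (hf : ContDiff ℝ k f) (v : F) :
    ContDiff ℝ k (fun x ↦ f x • v) :=
  hf.smul contDiff_const
end

/-! ### Diagonal metrics on ℝⁿ -/

/-- The partial derivative `∂ᵢ f`. -/
abbrev partialD (i : Fin n) (f : Model n → ℝ) (x : Model n) : ℝ :=
  fderiv ℝ f x (EuclideanSpace.single i 1)

/-- Smooth coefficients, bounded below by `1`, of a diagonal metric `∑ᵢ wᵢ dxᵢ²` on `ℝⁿ`. -/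
structure DiagWeight (n : ℕ) where
  toFun : Fin n → Model n → ℝ
  contDiff (i : Fin n) : ContDiff ℝ ∞ (toFun i)
  one_le (i : Fin n) (x : Model n) : 1 ≤ toFun i x

instance (n : ℕ) : CoeFun (DiagWeight n) (fun _ ↦ Fin n → Model n → ℝ) := ⟨DiagWeight.toFun⟩

namespace DiagWeight

variable (w : DiagWeight n)

lemma pos (i : Fin n) (x : Model n) : 0 < w i x := zero_lt_one.trans_le (w.one_le i x)

/-- The bilinear form `∑ᵢ wᵢ(x) dxᵢ ⊗ dxᵢ`. -/
def form (x : Model n) : Model n →L[ℝ] Model n →L[ℝ] ℝ :=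
  ∑ i, w i x • (EuclideanSpace.proj (𝕜 := ℝ) i : Model n →L[ℝ] ℝ).smulRight
    (EuclideanSpace.proj (𝕜 := ℝ) i : Model n →L[ℝ] ℝ)

lemma form_apply (x u v : Model n) : w.form x u v = ∑ i, w i x * (u i * v i) := by
  simp [form]

lemma form_comm (x u v : Model n) : w.form x u v = w.form x v u := by
  rw [form_apply, form_apply]
  exact Finset.sum_congr rfl fun i _ ↦ by ring

lemma norm_sq_le_form (x u : Model n) : ‖u‖ ^ 2 ≤ w.form x u u := by
  rw [form_apply, EuclideanSpace.norm_sq_eq]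
  refine Finset.sum_le_sum fun i _ ↦ ?_
  rw [Real.norm_eq_abs, sq_abs, ← sq]
  exact le_mul_of_one_le_left (sq_nonneg _) (w.one_le i x)

lemma contDiff_form : ContDiff ℝ ∞ w.form := by
  unfold form
  refine ContDiff.sum fun i _ ↦ ?_
  exact contDiff_smul_vector (w.contDiff i) _

/-- The Riemannian metric `∑ᵢ wᵢ dxᵢ²` on `ℝⁿ`. -/
def metric : ContMDiffRiemannianMetric (𝓡 n) ∞ (Model n)
    (fun x : Model n ↦ TangentSpace (𝓡 n) x) where
  inner x := w.form x
  symm x u v := w.form_comm x u v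
  pos x v hv := by
    have : 0 < ‖(show Model n from v)‖ := norm_pos_iff.2 hv
    exact (by positivity : (0:ℝ) < ‖(show Model n from v)‖ ^ 2).trans_le (w.norm_sq_le_form x v)
  isVonNBounded x := by
    change IsVonNBounded ℝ {v : Model n | w.form x v v < 1}
    refine (NormedSpace.isVonNBounded_ball ℝ (Model n) 1).subset fun v hv ↦ ?_
    rw [mem_ball_zero_iff]
    have := (w.norm_sq_le_form x v).trans_lt hv
    nlinarith [norm_nonneg v]
  contMDiff := contMDiff_bilinear_section w.contDiff_form

/-- The volume density `√(∏ᵢ wᵢ)`. -/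
def density (x : Model n) : ℝ := √(∏ i, w i x)

/-- The measure `√(∏ᵢ wᵢ) dx`. -/
def measure : Measure (Model n) :=
  volume.withDensity fun x ↦ ENNReal.ofReal (w.density x)

lemma density_pos (x : Model n) : 0 < w.density x :=
  Real.sqrt_pos.2 (Finset.prod_pos fun i _ ↦ w.pos i x)

lemma contDiff_density : ContDiff ℝ ∞ w.density :=
  (contDiff_prod fun i _ ↦ w.contDiff i).sqrt fun x ↦ (Finset.prod_pos fun i _ ↦ w.pos i x).ne'

end DiagWeight

/-! ### The Riemannian manifold of a diagonal metric, in coordinates -/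

/-- `ℝⁿ` with the Riemannian metric `∑ᵢ wᵢ dxᵢ²`. -/
def DiagSpace (_w : DiagWeight n) : Type := Model n

namespace DiagSpace
variable (w : DiagWeight n)
instance : TopologicalSpace (DiagSpace w) := inferInstanceAs (TopologicalSpace (Model n))
instance : T3Space (DiagSpace w) := inferInstanceAs (T3Space (Model n))
instance : ChartedSpace (Model n) (DiagSpace w) :=
  chartedSpaceSelf (Model n)
instance : IsManifold (𝓡 n) ∞ (DiagSpace w) := inferInstanceAs (IsManifold (𝓡 n) ∞ (Model n))
instance : IsManifold (𝓡 n) 1 (DiagSpace w) := inferInstanceAs (IsManifold (𝓡 n) 1 (Model n))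

/-- The Riemannian metric of `DiagSpace w`. -/
def metric : ContMDiffRiemannianMetric (𝓡 n) ∞ (Model n)
    (fun x : DiagSpace w ↦ TangentSpace (𝓡 n) x) := w.metric

instance : RiemannianBundle (fun x : DiagSpace w ↦ TangentSpace (𝓡 n) x) :=
  ⟨(metric w).toRiemannianMetric⟩
instance : IsContMDiffRiemannianBundle (𝓡 n) ∞ (Model n)
    (fun x : DiagSpace w ↦ TangentSpace (𝓡 n) x) :=
  ⟨(metric w).inner, (metric w).contMDiff, fun _ _ _ ↦ rfl⟩
instance : IsContinuousRiemannianBundle (Model n)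
    (fun x : DiagSpace w ↦ TangentSpace (𝓡 n) x) :=
  ⟨(metric w).inner, (metric w).contMDiff.continuous, fun _ _ _ ↦ rfl⟩
instance : MeasurableSpace (DiagSpace w) := inferInstanceAs (MeasurableSpace (Model n))
instance : BorelSpace (DiagSpace w) := inferInstanceAs (BorelSpace (Model n))

lemma inner_eq (x : DiagSpace w) (u v : TangentSpace (𝓡 n) x) :
    inner ℝ u v = w.form x u v := rfl

lemma coordVector_eq (c : DiagSpace w) (y : Model n) (i : Fin n) :
    coordVector (n := n) c y i = (EuclideanSpace.single i (1 : ℝ) : Model n) := by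
  change mfderiv (𝓡 n) (𝓡 n) (id : Model n → Model n) y _ = _
  rw [mfderiv_id]
  rfl

lemma metricMatrix_eq (c : DiagSpace w) (y : Model n) :
    metricMatrix (n := n) c y = Matrix.diagonal fun i ↦ w i y := by
  ext i j
  have h : metricMatrix (n := n) c y i j =
      w.form y (EuclideanSpace.single i 1) (EuclideanSpace.single j 1) := by
    simp only [metricMatrix, Matrix.of_apply]
    rw [coordVector_eq, coordVector_eq]
    rfl
  rw [h, DiagWeight.form_apply, Matrix.diagonal_apply]
  simp only [PiLp.single_apply]
  rcases eq_or_ne i j with rfl | hij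
  · simp
  · simp [hij, hij.symm]

lemma volDensity_eq (c : DiagSpace w) (y : Model n) :
    volDensity (n := n) c y = w.density y := by
  rw [volDensity, metricMatrix_eq, Matrix.det_diagonal]
  rfl

/-- A vector field on `DiagSpace w` in the standard coordinates of `ℝⁿ`. -/
def coord (Y : ∀ x : DiagSpace w, TangentSpace (𝓡 n) x) (x : Model n) : Model n := Y x

lemma coordComponent_eq (Y : ∀ x : DiagSpace w, TangentSpace (𝓡 n) x) (c : DiagSpace w)
    (i : Fin n) (y : Model n) : coordComponent Y c i y = coord w Y y i := by
  have h : (mfderiv (𝓡 n) (𝓡 n) (id : Model n → Model n) y : Model n → Model n)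
      (coord w Y y) = coord w Y y := by
    rw [mfderiv_id]
    rfl
  exact congrArg (fun z : Model n ↦ z i) h

lemma divergence_eq (Y : ∀ x : DiagSpace w, TangentSpace (𝓡 n) x) (x : DiagSpace w) :
    divergence Y x = (w.density x)⁻¹ *
      ∑ i, partialD i (fun y ↦ w.density y * coord w Y y i) x := by
  simp only [divergence, volDensity_eq, coordComponent_eq]
  rfl

lemma inner_grad (f : DiagSpace w → ℝ) (x : DiagSpace w) (u : TangentSpace (𝓡 n) x) :
    inner ℝ (grad (n := n) f x) u = mfderiv (𝓡 n) 𝓘(ℝ, ℝ) f x u :=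
  InnerProductSpace.toDual_symm_apply

lemma grad_eq (f : DiagSpace w → ℝ) (x : Model n) (i : Fin n) :
    coord w (grad (n := n) f) x i = (w i x)⁻¹ * partialD i f x := by
  have h : w.form x (coord w (grad (n := n) f) x) (EuclideanSpace.single i (1 : ℝ)) =
      partialD i f x := by
    refine (inner_grad w f x (EuclideanSpace.single i (1 : ℝ) : Model n)).trans ?_
    exact congr($(mfderiv_eq_fderiv (f := (show Model n → ℝ from f)) (x := x))
      (EuclideanSpace.single i (1 : ℝ)))
  rw [w.form_apply] at h
  rw [← h]
  have := (w.pos i x).ne'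
  simp [PiLp.single_apply, this]

lemma laplacian_eq (f : DiagSpace w → ℝ) (x : DiagSpace w) :
    laplacian n f x = (w.density x)⁻¹ *
      ∑ i, partialD i (fun y ↦ w.density y * ((w i y)⁻¹ * partialD i f y)) x := by
  rw [laplacian, divergence_eq]
  simp only [grad_eq]

/-- Every preferred chart is the identity, so the chart measure is global and independent of `c`;
the supremum over charts is then constant. -/
lemma chartVolume_eq (c : DiagSpace w) : chartVolume (n := n) c = w.measure := by
  have e : extChartAt (𝓡 n) c = (PartialEquiv.refl (Model n) : PartialEquiv (DiagSpace w) (Model n)) :=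
    extChartAt_model_space_eq_id (𝕜 := ℝ) (E := Model n) c
  simp only [chartVolume, volDensity_eq]
  rw [e]
  refine (Measure.map_id (μ := ((volume : Measure (Model n)).restrict Set.univ).withDensity
    fun y ↦ ENNReal.ofReal (w.density y))).trans ?_
  rw [Measure.restrict_univ]
  rfl

lemma riemannianVolume_eq : riemannianVolume n (DiagSpace w) = w.measure := by
  have : Nonempty (DiagSpace w) := inferInstanceAs (Nonempty (Model n))
  simp only [riemannianVolume, chartVolume_eq]
  exact ciSup_const

lemma isSmoothField_iff (Y : ∀ x : DiagSpace w, TangentSpace (𝓡 n) x) :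
    IsSmoothField Y ↔ ContDiff ℝ ∞ (coord w Y) :=
  contMDiff_vectorSpace_iff_contDiff (E := Model n) (V := coord w Y)

lemma isTestFunction_iff (f : Model n → ℝ) :
    IsTestFunction (n := n) (M := DiagSpace w) f ↔ ContDiff ℝ ∞ f ∧ HasCompactSupport f :=
  and_congr (contMDiff_iff_contDiff (f := f)) Iff.rfl

lemma isTestField_iff (Y : ∀ x : DiagSpace w, TangentSpace (𝓡 n) x) :
    IsTestField Y ↔ ContDiff ℝ ∞ (coord w Y) ∧
      HasCompactSupport (coord w Y) := by
  rw [IsTestField, isSmoothField_iff]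
  rfl

/-! ### Riemannian distance and completeness -/

instance : EMetricSpace (DiagSpace w) := EMetricSpace.ofRiemannianMetric (𝓡 n) (DiagSpace w)

instance : IsRiemannianManifold (𝓡 n) (DiagSpace w) := ⟨fun _ _ ↦ rfl⟩

lemma norm_sq_eq (x : DiagSpace w) (u : TangentSpace (𝓡 n) x) : ‖u‖ ^ 2 = w.form x u u := by
  rw [← real_inner_self_eq_norm_sq, inner_eq]

lemma norm_le_norm (x : DiagSpace w) (u : Model n) :
    ‖u‖ ≤ @norm (TangentSpace (𝓡 n) x) _ u := by
  have h := (w.norm_sq_le_form x u).trans (norm_sq_eq w x u).ge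
  exact (pow_le_pow_iff_left₀ (norm_nonneg _) (norm_nonneg _) two_ne_zero).1 h

lemma enorm_le_enorm (x : DiagSpace w) (u : Model n) :
    ‖u‖ₑ ≤ @enorm (TangentSpace (𝓡 n) x) _ u :=
  ENNReal.coe_le_coe.2 (norm_le_norm w x u)

/-- Since the weights are at least `1`, the Riemannian length of a path dominates its Euclidean
length, which dominates the distance of its endpoints. -/
lemma edist_le (x y : Model n) : edist x y ≤ @edist (DiagSpace w) _ x y := by
  refine le_of_forall_gt fun r hr ↦ ?_
  obtain ⟨γ, h0, h1, hγ, hlt⟩ : ∃ γ : ℝ → Model n, γ 0 = x ∧ γ 1 = y ∧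
      ContMDiffOn 𝓘(ℝ, ℝ) (𝓡 n) 1 γ (Set.Icc 0 1) ∧
      Manifold.pathELength (𝓡 n) (M := DiagSpace w) γ 0 1 < r :=
    Manifold.exists_lt_of_riemannianEDist_lt (I := 𝓡 n) (M := DiagSpace w) hr
  have D : ContDiffOn ℝ 1 γ (Set.Icc 0 1) := contMDiffOn_iff_contDiffOn.mp hγ
  refine lt_of_le_of_lt (le_trans ?_ (Manifold.pathELength_eq_lintegral_mfderivWithin_Icc
    (I := 𝓡 n) (M := DiagSpace w) (γ := γ) (a := 0) (b := 1)).ge) hlt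
  rw [edist_comm, edist_eq_enorm_sub, ← h0, ← h1]
  refine (enorm_sub_le_lintegral_derivWithin_Icc_of_contDiffOn_Icc D zero_le_one).trans ?_
  refine lintegral_mono fun t ↦ ?_
  have h : (mfderivWithin 𝓘(ℝ, ℝ) (𝓡 n) γ (Set.Icc 0 1) t : ℝ → Model n) 1
      = derivWithin γ (Set.Icc 0 1) t := by
    rw [mfderivWithin_eq_fderivWithin]
    rfl
  exact (congrArg (fun z : Model n ↦ ‖z‖ₑ) h.symm).le.trans (enorm_le_enorm w (γ t) _)

instance : CompleteSpace (DiagSpace w) := by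
  refine EMetric.complete_of_cauchySeq_tendsto fun u hu ↦ ?_
  let u' : ℕ → Model n := u
  have h : CauchySeq u' := by
    rw [EMetric.cauchySeq_iff] at hu ⊢
    intro ε hε
    obtain ⟨N, hN⟩ := hu ε hε
    exact ⟨N, fun m hm k hk ↦ (edist_le w (u m) (u k)).trans_lt (hN m hm k hk)⟩
  -- The Euclidean limit is a limit in `DiagSpace w` because both distances induce the same
  -- topology.
  exact cauchySeq_tendsto_of_complete (α := Model n) (u := u') h

instance : ConnectedSpace (DiagSpace w) := inferInstanceAs (ConnectedSpace (Model n))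
instance : SecondCountableTopology (DiagSpace w) :=
  inferInstanceAs (SecondCountableTopology (Model n))

lemma noncompactSpace [NeZero n] : NoncompactSpace (DiagSpace w) :=
  inferInstanceAs (NoncompactSpace (Model n))

end DiagSpace

/-! ### Integration by parts against the Riemannian density -/

lemma contDiff_partialD {f : Model n → ℝ} (hf : ContDiff ℝ ∞ f) (i : Fin n) :
    ContDiff ℝ ∞ (partialD i f) :=
  (hf.fderiv_right (by simp)).clm_apply contDiff_const

lemma integral_mul_partialD {u g : Model n → ℝ} (hu : ContDiff ℝ ∞ u) (hg : ContDiff ℝ ∞ g)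
    (hgc : HasCompactSupport g) (i : Fin n) :
    ∫ x, u x * partialD i g x = - ∫ x, partialD i u x * g x := by
  have hu' := (contDiff_partialD hu i).continuous
  have hg' := (contDiff_partialD hg i).continuous
  have hgc' : HasCompactSupport (partialD i g) := hgc.fderiv_apply ℝ _
  exact integral_mul_fderiv_eq_neg_fderiv_mul_of_integrable
    ((hu'.mul hg.continuous).integrable_of_hasCompactSupport hgc.mul_left)
    ((hu.continuous.mul hg').integrable_of_hasCompactSupport hgc'.mul_left)
    ((hu.continuous.mul hg.continuous).integrable_of_hasCompactSupport hgc.mul_left)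
    (fun x _ ↦ hu.differentiable (by simp) x) (fun x _ ↦ hg.differentiable (by simp) x)

namespace DiagWeight
variable (w : DiagWeight n)

lemma integral_measure (f : Model n → ℝ) :
    ∫ x, f x ∂w.measure = ∫ x, w.density x * f x := by
  rw [measure, integral_withDensity_eq_integral_toReal_smul
    w.contDiff_density.continuous.measurable.ennreal_ofReal (by simp)]
  simp [ENNReal.toReal_ofReal (w.density_pos _).le]

instance : IsLocallyFiniteMeasure w.measure :=
  IsLocallyFiniteMeasure.withDensity_ofReal w.contDiff_density.continuous

lemma contDiff_inv (i : Fin n) : ContDiff ℝ ∞ fun x ↦ (w i x)⁻¹ :=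
  (w.contDiff i).inv fun x ↦ (w.pos i x).ne'

/-- The component `√g gⁱⁱ ∂ᵢ v` of the flux of `∇v`. -/
def flux (v : Model n → ℝ) (i : Fin n) (x : Model n) : ℝ :=
  w.density x * ((w i x)⁻¹ * partialD i v x)

lemma contDiff_flux {v : Model n → ℝ} (hv : ContDiff ℝ ∞ v) (i : Fin n) :
    ContDiff ℝ ∞ (w.flux v i) :=
  w.contDiff_density.mul ((w.contDiff_inv i).mul (contDiff_partialD hv i))

/-- The divergence theorem for `v Y` with respect to `√g dx`. -/
lemma integral_partialD_mul_eq {v : Model n → ℝ} (hv : ContDiff ℝ ∞ v) {Y : Model n → Model n}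
    (hY : ContDiff ℝ ∞ Y) (hYc : HasCompactSupport Y) :
    ∫ x, w.density x * ∑ i, partialD i v x * Y x i =
      -∫ x, w.density x * (v x * ((w.density x)⁻¹ *
        ∑ i, partialD i (fun x ↦ w.density x * Y x i) x)) := by
  have hs (i : Fin n) : ContDiff ℝ ∞ fun x ↦ Y x i := contDiff_euclidean.1 hY i
  have hc (i : Fin n) : HasCompactSupport fun x ↦ Y x i :=
    hYc.comp_left (g := fun z : Model n ↦ z i) rfl
  have hs' (i : Fin n) : ContDiff ℝ ∞ fun x ↦ w.density x * Y x i :=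
    w.contDiff_density.mul (hs i)
  have hc' (i : Fin n) : HasCompactSupport fun x ↦ w.density x * Y x i := (hc i).mul_left
  calc ∫ x, w.density x * ∑ i, partialD i v x * Y x i
      = ∫ x, ∑ i, partialD i v x * (w.density x * Y x i) := by
        congr with x
        rw [Finset.mul_sum]
        exact Finset.sum_congr rfl fun i _ ↦ by ring
    _ = ∑ i, ∫ x, partialD i v x * (w.density x * Y x i) :=
        integral_finsetSum _ fun i _ ↦ ((contDiff_partialD hv i).continuous.mul
          (hs' i).continuous).integrable_of_hasCompactSupport (hc' i).mul_left
    _ = -∑ i, ∫ x, v x * partialD i (fun x ↦ w.density x * Y x i) x := by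
        rw [← Finset.sum_neg_distrib]
        exact Finset.sum_congr rfl fun i _ ↦ by rw [integral_mul_partialD hv (hs' i) (hc' i), neg_neg]
    _ = -∫ x, ∑ i, v x * partialD i (fun x ↦ w.density x * Y x i) x := by
        congr 1
        exact (integral_finsetSum _ fun i _ ↦ (hv.continuous.mul
          (contDiff_partialD (hs' i) i).continuous).integrable_of_hasCompactSupport
            ((hc' i).fderiv_apply ℝ _).mul_left).symm
    _ = -∫ x, w.density x * (v x * ((w.density x)⁻¹ *
          ∑ i, partialD i (fun x ↦ w.density x * Y x i) x)) := by
        congr with x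
        have := (w.density_pos x).ne'
        rw [← Finset.mul_sum]
        field_simp

end DiagWeight

/-! ### Distributional Laplacian and weak gradient of smooth functions -/

namespace DiagSpace
variable (w : DiagWeight n)

lemma integral_volume (f : DiagSpace w → ℝ) :
    ∫ x, f x ∂(riemannianVolume n (DiagSpace w)) = ∫ x : Model n, w.density x * f x := by
  rw [riemannianVolume_eq]
  exact w.integral_measure f

lemma locallyIntegrable_volume {f : Model n → ℝ} (hf : Continuous f) :
    LocallyIntegrable (X := DiagSpace w) f (riemannianVolume n (DiagSpace w)) := by
  rw [riemannianVolume_eq]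
  exact hf.locallyIntegrable (X := Model n) (μ := w.measure)

/-- Green's identity: two integrations by parts move the operator from the test function to `v`. The
density in the measure cancels its inverse in the Laplacian, so only fluxes remain. -/
lemma isDistribLaplacian {v h : Model n → ℝ} (hv : ContDiff ℝ ∞ v) (hh : Continuous h)
    (heq : ∀ x, w.density x * h x = ∑ i, partialD i (w.flux v i) x) :
    IsDistribLaplacian (n := n) (M := DiagSpace w) v h := by
  refine ⟨locallyIntegrable_volume w hv.continuous, locallyIntegrable_volume w hh,
    fun φ hφ ↦ ?_⟩
  obtain ⟨φs, φc⟩ := (isTestFunction_iff w φ).1 hφ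
  simp only [laplacian_eq]
  refine (integral_volume w _).trans (Eq.trans ?_ (integral_volume w _).symm)
  have hc (i : Fin n) : HasCompactSupport (w.flux φ i) :=
    ((φc.fderiv_apply ℝ _).mul_left (f := fun x ↦ (w i x)⁻¹)).mul_left
  calc ∫ x, w.density x * (v x * ((w.density x)⁻¹ * ∑ i, partialD i (w.flux φ i) x))
      = ∫ x, ∑ i, v x * partialD i (w.flux φ i) x := by
        congr with x
        have := (w.density_pos x).ne'
        rw [← Finset.mul_sum]
        field_simp
    _ = ∑ i, ∫ x, v x * partialD i (w.flux φ i) x :=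
        integral_finsetSum _ fun i _ ↦ (hv.continuous.mul
          (contDiff_partialD (w.contDiff_flux φs i) i).continuous).integrable_of_hasCompactSupport
            ((hc i).fderiv_apply ℝ _).mul_left
    _ = ∑ i, ∫ x, partialD i (w.flux v i) x * φ x := by
        refine Finset.sum_congr rfl fun i _ ↦ ?_
        -- Both sides become minus the integral of `√g gⁱⁱ ∂ᵢv ∂ᵢφ`, which is symmetric in `v` and
        -- `φ`.
        rw [integral_mul_partialD hv (w.contDiff_flux φs i) (hc i), ← neg_eq_iff_eq_neg.2
          (integral_mul_partialD (w.contDiff_flux hv i) φs φc i)]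
        congr 1
        congr with x
        simp only [DiagWeight.flux]
        ring
    _ = ∫ x, ∑ i, partialD i (w.flux v i) x * φ x :=
        (integral_finsetSum _ fun i _ ↦ ((contDiff_partialD (w.contDiff_flux hv i) i).continuous.mul
          φs.continuous).integrable_of_hasCompactSupport φc.mul_left).symm
    _ = ∫ x, w.density x * (h x * φ x) := by
        congr with x
        rw [← Finset.sum_mul, ← heq]
        ring

lemma inner_grad_eq_sum (v : DiagSpace w → ℝ) (Y : ∀ x : DiagSpace w, TangentSpace (𝓡 n) x)
    (x : DiagSpace w) :
    inner ℝ (grad (n := n) v x) (Y x) = ∑ i, partialD i v x * coord w Y x i := by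
  refine (inner_eq w x _ _).trans ((w.form_apply x (coord w (grad (n := n) v) x)
    (coord w Y x)).trans (Finset.sum_congr rfl fun i _ ↦ ?_))
  have h {a b c d : ℝ} (ha : a ≠ 0) (hb : b = a⁻¹ * c) : a * (b * d) = c * d := by
    rw [hb]
    field_simp
  exact h (w.pos i x).ne' (grad_eq w v x i)

lemma norm_grad (v : DiagSpace w → ℝ) (x : DiagSpace w) :
    ‖grad (n := n) v x‖ = √(∑ i, (w i x)⁻¹ * partialD i v x ^ 2) := by
  rw [← Real.sqrt_sq (norm_nonneg _), ← real_inner_self_eq_norm_sq, inner_grad_eq_sum]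
  congr 1
  have h {a b c : ℝ} (hb : b = a * c) : c * b = a * c ^ 2 := by
    rw [hb]
    ring
  exact Finset.sum_congr rfl fun i _ ↦ h (grad_eq w v x i)

lemma continuous_norm_grad {v : Model n → ℝ} (hv : ContDiff ℝ ∞ v) :
    Continuous fun x : DiagSpace w ↦ ‖grad (n := n) (M := DiagSpace w) v x‖ := by
  have h : Continuous fun x : Model n ↦ √(∑ i, (w i x)⁻¹ * partialD i v x ^ 2) :=
    (continuous_finsetSum _ fun i _ ↦ (w.contDiff_inv i).continuous.mul
      ((contDiff_partialD hv i).continuous.pow 2)).sqrt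
  exact (continuous_congr (norm_grad w v)).2 h

lemma isWeakGradient_grad {v : DiagSpace w → ℝ} (hv : ContDiff ℝ ∞ (E := Model n) v) :
    IsWeakGradient v (grad (n := n) v) := by
  refine ⟨locallyIntegrable_volume w hv.continuous,
    locallyIntegrable_volume w (continuous_norm_grad w hv), fun Y hY ↦ ?_⟩
  obtain ⟨Ys, Yc⟩ := (isTestField_iff w Y).1 hY
  have hcont : Continuous fun x ↦ ∑ i, partialD i v x * coord w Y x i :=
    continuous_finsetSum _ fun i _ ↦ (contDiff_partialD hv i).continuous.mul
      (contDiff_euclidean.1 Ys i).continuous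
  refine ⟨(hcont.aestronglyMeasurable (α := Model n)).congr
    (.of_forall fun x ↦ (inner_grad_eq_sum w v Y x).symm),
    (integral_congr_ae (.of_forall (inner_grad_eq_sum w v Y))).trans ?_⟩
  simp only [divergence_eq]
  refine (integral_volume w _).trans (Eq.trans ?_ congr(-$(integral_volume w _)).symm)
  exact w.integral_partialD_mul_eq hv Ys Yc

/-- Testing a weak gradient `X` of `v` against a field `Y` with `‖Y‖ ≤ 1` supported in `S`. -/
lemma integral_inner_grad_le {v : DiagSpace w → ℝ} (hv : ContDiff ℝ ∞ (E := Model n) v)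
    {X : ∀ x : DiagSpace w, TangentSpace (𝓡 n) x} (hX : IsWeakGradient v X) {p : ℝ} (hp : 1 ≤ p)
    (hXp : MemLp (fun x ↦ ‖X x‖) (ENNReal.ofReal p) (riemannianVolume n (DiagSpace w)))
    {Y : ∀ x : DiagSpace w, TangentSpace (𝓡 n) x} (hY : IsTestField Y) (hY1 : ∀ x, ‖Y x‖ ≤ 1)
    {S : Set (DiagSpace w)} (hYS : ∀ x ∉ S, Y x = 0)
    (hS : riemannianVolume n (DiagSpace w) S ≠ ⊤) :
    ∫ x : Model n, w.density x * ∑ i, partialD i v x * coord w Y x i ≤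
      (eLpNorm (fun x ↦ ‖X x‖) (ENNReal.ofReal p) (riemannianVolume n (DiagSpace w))).toReal *
        (riemannianVolume n (DiagSpace w) S).toReal ^ (1 - 1 / p) := by
  set μ := riemannianVolume n (DiagSpace w) with hμ
  have h1 : ∫ x : Model n, w.density x * ∑ i, partialD i v x * coord w Y x i =
      ∫ x, inner ℝ (X x) (Y x) ∂μ := by
    -- Both `X` and the classical gradient pair with `Y` to `-∫ v div Y`; uniqueness of weak
    -- gradients is not needed.
    rw [(hX.2.2 Y hY).2, ← ((isWeakGradient_grad w hv).2.2 Y hY).2]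
    simp only [inner_grad_eq_sum]
    exact (integral_volume w _).symm
  have hp1 : (1 : ENNReal) ≤ ENNReal.ofReal p := by
    rw [← ENNReal.ofReal_one]
    exact ENNReal.ofReal_le_ofReal hp
  have : IsFiniteMeasure (μ.restrict S) := ⟨by simpa using hS.lt_top⟩
  have hXS : Integrable (fun x ↦ ‖X x‖) (μ.restrict S) :=
    memLp_one_iff_integrable.1 ((hXp.restrict S).mono_exponent hp1)
  -- Hölder on `S`, as a comparison of the `L¹` and `L^p` norms on a set of finite measure.
  have h2 := eLpNorm_le_eLpNorm_mul_rpow_measure_univ hp1 (hXp.restrict S).aestronglyMeasurable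
  rw [Measure.restrict_apply_univ, ENNReal.toReal_ofReal (by linarith), ENNReal.toReal_one,
    one_div_one, eLpNorm_one_eq_lintegral_enorm] at h2
  have hfin : eLpNorm (fun x ↦ ‖X x‖) (ENNReal.ofReal p) μ * μ S ^ (1 - 1 / p) ≠ ⊤ :=
    ENNReal.mul_ne_top hXp.eLpNorm_ne_top (ENNReal.rpow_ne_top_of_nonneg
      (by rw [sub_nonneg, div_le_one (by linarith)]; exact hp) hS)
  rw [h1, ENNReal.toReal_rpow, ← ENNReal.toReal_mul]
  calc ∫ x, inner ℝ (X x) (Y x) ∂μ = ∫ x in S, inner ℝ (X x) (Y x) ∂μ :=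
        (setIntegral_eq_integral_of_forall_compl_eq_zero fun x hx ↦ by
          rw [hYS x hx, inner_zero_right]).symm
    _ ≤ ∫ x in S, ‖X x‖ ∂μ := by
        have hle (x : DiagSpace w) : ‖X x‖ * ‖Y x‖ ≤ ‖X x‖ :=
          mul_le_of_le_one_right (norm_nonneg _) (hY1 x)
        refine integral_mono_ae (hXS.mono' (hX.2.2 Y hY).1.restrict (.of_forall fun x ↦ ?_)) hXS
          (.of_forall fun x ↦ (real_inner_le_norm _ _).trans (hle x))
        exact (norm_inner_le_norm _ _).trans (hle x)
    _ = (∫⁻ x in S, ‖‖X x‖‖ₑ ∂μ).toReal := by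
        rw [integral_eq_lintegral_of_nonneg_ae (.of_forall fun _ ↦ norm_nonneg _)
          hXS.aestronglyMeasurable]
        simp only [ofReal_norm, enorm_norm]
    _ ≤ _ := ENNReal.toReal_mono hfin
        (h2.trans (by gcongr; exact Measure.restrict_le_self))
end DiagSpace

/-! ### The profiles `φ` and `η` -/

section Profile

lemma partialD_eq_of_eventuallyEq {f g : Model n → ℝ} {x : Model n} (h : f =ᶠ[𝓝 x] g) (i : Fin n) :
    partialD i f x = partialD i g x := by
  rw [partialD, h.fderiv_eq]

lemma partialD_eventuallyEq {f g : Model n → ℝ} {x : Model n} (h : f =ᶠ[𝓝 x] g) (i : Fin n) :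
    partialD i f =ᶠ[𝓝 x] partialD i g :=
  h.fderiv.mono fun y hy ↦ by rw [partialD, partialD, hy]

lemma partialD_coord (i j : Fin n) (x : Model n) :
    partialD i (fun y : Model n ↦ y j) x = if j = i then 1 else 0 := by
  have h : fderiv ℝ (fun y : Model n ↦ y j) x = (EuclideanSpace.proj (𝕜 := ℝ) j : Model n →L[ℝ] ℝ) :=
    (EuclideanSpace.proj (𝕜 := ℝ) j : Model n →L[ℝ] ℝ).fderiv
  rw [partialD, h]
  simp [PiLp.single_apply]

lemma partialD_const (i : Fin n) (c : ℝ) (x : Model n) : partialD i (fun _ ↦ c) x = 0 := by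
  simp [partialD]

/-- A pair of profiles: `φ` is a cut-off of the coordinate function `x_{i₀}`, and `η` is a cut-off
which vanishes near the origin and equals `1` wherever `φ` is neither zero nor `x_{i₀}`. -/
lemma exists_profile (i₀ : Fin n) : ∃ φ η : Model n → ℝ, ContDiff ℝ ∞ φ ∧ ContDiff ℝ ∞ η ∧
    tsupport φ ⊆ Metric.closedBall 0 (1 / 4) ∧ tsupport η ⊆ Metric.closedBall 0 (1 / 4) ∧
    (∀ x, 0 ≤ η x) ∧ (∀ x, η x ≤ 1) ∧
    (∀ x ∈ Metric.ball (0 : Model n) (1 / 16),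
      η x = 0 ∧ ∀ i, partialD i φ x = if i₀ = i then 1 else 0) ∧
    ∀ x, η x = 1 ∨ (∀ i, i ≠ i₀ → partialD i φ x = 0) ∧ ∑ i, partialD i (partialD i φ) x = 0 := by
  -- The radii are nested so that `η = 1` on `1/10 ≤ ‖x‖ ≤ 1/5`, a shell containing the transition
  -- region `1/8 ≤ ‖x‖ ≤ 1/6` of `χ`. Both transitions of `η` thus happen where `φ` is linear or
  -- zero.
  let χ : ContDiffBump (0 : Model n) := ⟨1 / 8, 1 / 6, by norm_num, by norm_num⟩
  let χs : ContDiffBump (0 : Model n) := ⟨1 / 16, 1 / 10, by norm_num, by norm_num⟩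
  let χb : ContDiffBump (0 : Model n) := ⟨1 / 5, 1 / 4, by norm_num, by norm_num⟩
  have hφ : ∀ x ∈ Metric.ball (0 : Model n) (1 / 8),
      (fun x : Model n ↦ x i₀ * χ x) =ᶠ[𝓝 x] fun x ↦ x i₀ := fun x hx ↦ by
    filter_upwards [Metric.isOpen_ball.mem_nhds hx] with y hy
    rw [χ.one_of_mem_closedBall (Metric.ball_subset_closedBall hy), mul_one]
  have hp : ∀ x ∈ Metric.ball (0 : Model n) (1 / 8), ∀ i,
      partialD i (fun x : Model n ↦ x i₀ * χ x) x = if i₀ = i then 1 else 0 := fun x hx i ↦ by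
    rw [partialD_eq_of_eventuallyEq (hφ x hx), partialD_coord]
  refine ⟨fun x ↦ x i₀ * χ x, fun x ↦ χb x * (1 - χs x), ?_, ?_, ?_, ?_, ?_, ?_, ?_, ?_⟩
  · exact (contDiff_euclidean.1 contDiff_id i₀).mul χ.contDiff
  · exact χb.contDiff.mul (contDiff_const.sub χs.contDiff)
  · refine (tsupport_mul_subset_right (f := fun x : Model n ↦ x i₀) (g := χ)).trans ?_
    rw [χ.tsupport_eq]
    exact Metric.closedBall_subset_closedBall (by norm_num [χ])
  · refine (tsupport_mul_subset_left (f := χb) (g := fun x ↦ 1 - χs x)).trans ?_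
    rw [χb.tsupport_eq]
  · exact fun x ↦ mul_nonneg χb.nonneg (sub_nonneg.2 χs.le_one)
  · exact fun x ↦ mul_le_one₀ χb.le_one (sub_nonneg.2 χs.le_one) (sub_le_self _ χs.nonneg)
  · intro x hx
    refine ⟨?_, hp x (Metric.ball_subset_ball (by norm_num) hx)⟩
    simp only [χs.one_of_mem_closedBall (Metric.ball_subset_closedBall hx), sub_self, mul_zero]
  · intro x
    rcases lt_or_ge ‖x‖ (1 / 8) with h | h
    · have hx : x ∈ Metric.ball (0 : Model n) (1 / 8) := by simpa using h
      refine .inr ⟨fun i hi ↦ by rw [hp x hx, if_neg hi.symm], Finset.sum_eq_zero fun i _ ↦ ?_⟩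
      have : partialD i (fun x : Model n ↦ x i₀ * χ x) =ᶠ[𝓝 x] fun _ ↦ if i₀ = i then 1 else 0 := by
        filter_upwards [Metric.isOpen_ball.mem_nhds hx] with y hy using hp y hy i
      rw [partialD_eq_of_eventuallyEq this, partialD_const]
    rcases le_or_gt ‖x‖ (1 / 5) with h' | h'
    · left
      simp only [χb.one_of_mem_closedBall (x := x) (by simpa [χb] using h'),
        χs.zero_of_le_dist (x := x) (by simp only [dist_zero_right, χs]; linarith)]
      norm_num
    · right
      have h0 : (fun x : Model n ↦ x i₀ * χ x) =ᶠ[𝓝 x] fun _ ↦ 0 := by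
        filter_upwards [(isOpen_lt continuous_const continuous_norm).mem_nhds h'] with y hy
        rw [χ.zero_of_le_dist (by simp only [dist_zero_right, χ]; linarith [Set.mem_ofPred.1 hy]), mul_zero]
      have h1 (i : Fin n) : partialD i (fun x : Model n ↦ x i₀ * χ x) =ᶠ[𝓝 x] fun _ ↦ 0 :=
        (partialD_eventuallyEq h0 i).trans (.of_forall fun y ↦ partialD_const i 0 y)
      exact ⟨fun i _ ↦ (h1 i).eq_of_nhds, Finset.sum_eq_zero fun i _ ↦ by
        rw [partialD_eq_of_eventuallyEq (h1 i), partialD_const]⟩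

lemma tsupport_partialD_subset (f : Model n → ℝ) (i : Fin n) :
    tsupport (partialD i f) ⊆ tsupport f := by
  refine (closure_mono (Function.support_subset_iff'.2 fun x hx ↦ ?_)).trans
    (tsupport_fderiv_subset ℝ)
  rw [partialD, Function.notMem_support.1 hx]
  rfl

end Profile

/-! ### Stretched cells and gluing -/

section Glue

variable (i₀ i₁ : Fin n) (D : ℤ → ℝ)

/-- The stretching factors: `D k` in the directions `i₀`, `i₁` and `1` in the others. -/
def stretch (k : ℤ) (i : Fin n) : ℝ := if i = i₀ ∨ i = i₁ then D k else 1

/-- The linear map multiplying the coordinates by the stretching factors. -/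
def stretchL (k : ℤ) : Model n →ₗ[ℝ] Model n :=
  Matrix.toLpLin 2 2 (Matrix.diagonal (stretch i₀ i₁ D k))

lemma stretchL_apply (k : ℤ) (x : Model n) (i : Fin n) :
    stretchL i₀ i₁ D k x i = stretch i₀ i₁ D k i * x i := by
  simp [stretchL, Matrix.toLpLin_apply, Matrix.mulVec_diagonal]

variable {i₀ i₁} in
lemma prod_ite_pair (h : i₀ ≠ i₁) (c : ℝ) : ∏ i, (if i = i₀ ∨ i = i₁ then c else 1) = c * c := by
  rw [Finset.prod_ite, Finset.prod_const_one, mul_one, Finset.prod_const,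
    show Finset.univ.filter (fun i ↦ i = i₀ ∨ i = i₁) = {i₀, i₁} by ext; simp,
    Finset.card_pair h, sq]

variable {i₀ i₁} in
lemma det_stretchL (h : i₀ ≠ i₁) (k : ℤ) : LinearMap.det (stretchL i₀ i₁ D k) = D k * D k := by
  rw [stretchL, Matrix.toLpLin_eq_toLin, LinearMap.det_toLin, Matrix.det_diagonal]
  exact prod_ite_pair h (D k)

/-- The affine map which sends the point `k e_{i₀}` to the origin and stretches. -/
def rescale (k : ℤ) (x : Model n) : Model n :=
  stretchL i₀ i₁ D k (x - EuclideanSpace.single i₀ (k : ℝ))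

lemma contDiff_rescale (k : ℤ) : ContDiff ℝ ∞ (rescale i₀ i₁ D k) :=
  (LinearMap.toContinuousLinearMap (stretchL i₀ i₁ D k)).contDiff.comp
    (contDiff_id.sub contDiff_const)

variable {i₀ i₁ D} in
lemma volume_preimage_rescale (h : i₀ ≠ i₁) (hD : ∀ k, 1 ≤ D k) (k : ℤ) (S : Set (Model n)) :
    volume (rescale i₀ i₁ D k ⁻¹' S) = ENNReal.ofReal (D k * D k)⁻¹ * volume S := by
  have hk : 0 < D k * D k := by nlinarith [hD k]
  have := Measure.addHaar_preimage_linearMap (volume : Measure (Model n))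
    (f := stretchL i₀ i₁ D k) (by rw [det_stretchL D h]; exact hk.ne') S
  rw [det_stretchL D h, abs_of_pos (inv_pos.2 hk)] at this
  rw [← this]
  refine Eq.trans ?_ (measure_preimage_add_right volume (-EuclideanSpace.single i₀ (k : ℝ))
    (stretchL i₀ i₁ D k ⁻¹' S))
  simp only [← sub_eq_add_neg]
  rfl

variable {i₀ i₁ D} in
lemma abs_sub_le_norm_rescale (hD : ∀ k, 1 ≤ D k) (k : ℤ) (x : Model n) :
    |x i₀ - k| ≤ ‖rescale i₀ i₁ D k x‖ := by
  refine le_trans ?_ (PiLp.norm_apply_le (rescale i₀ i₁ D k x) i₀)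
  rw [rescale, stretchL_apply, stretch, if_pos (.inl rfl), Real.norm_eq_abs, abs_mul]
  simpa using le_mul_of_one_le_left (abs_nonneg (x i₀ - k)) ((hD k).trans (le_abs_self _))

lemma partialD_comp_rescale {f : Model n → ℝ} (hf : ContDiff ℝ ∞ f) (k : ℤ) (i : Fin n)
    (x : Model n) : partialD i (fun y ↦ f (rescale i₀ i₁ D k y)) x =
      stretch i₀ i₁ D k i * partialD i f (rescale i₀ i₁ D k x) := by
  have h1 : HasFDerivAt (rescale i₀ i₁ D k)
      (LinearMap.toContinuousLinearMap (stretchL i₀ i₁ D k)) x :=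
    (LinearMap.toContinuousLinearMap (stretchL i₀ i₁ D k)).hasFDerivAt.comp x
      ((hasFDerivAt_id x).sub_const _)
  have h2 : stretchL i₀ i₁ D k (EuclideanSpace.single i 1) =
      stretch i₀ i₁ D k i • EuclideanSpace.single i (1 : ℝ) := by
    ext j
    rw [stretchL_apply]
    rcases eq_or_ne j i with rfl | hj
    · simp
    · simp [hj]
  have h3 := ((hf.differentiable (by simp) (rescale i₀ i₁ D k x)).hasFDerivAt.comp x h1).fderiv
  change fderiv ℝ (f ∘ rescale i₀ i₁ D k) x _ = _
  rw [h3]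
  simp [h2]

/-- The function which is `c k • f` transplanted to the `k`-th stretched cell, for every `k`. -/
def glue (f : Model n → ℝ) (c : ℤ → ℝ) (x : Model n) : ℝ :=
  c (round (x i₀)) * f (rescale i₀ i₁ D (round (x i₀)) x)

variable {i₀ i₁ D}

lemma eq_zero_of_abs_sub (hD : ∀ k, 1 ≤ D k) {f : Model n → ℝ}
    (hf : tsupport f ⊆ Metric.closedBall 0 (1 / 4)) {k : ℤ} {x : Model n}
    (hx : 1 / 4 < |x i₀ - k|) : f (rescale i₀ i₁ D k x) = 0 := by
  by_contra h
  have := hf (subset_tsupport f h)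
  rw [mem_closedBall_zero_iff] at this
  linarith [abs_sub_le_norm_rescale (i₀ := i₀) (i₁ := i₁) hD k x]

/-- The jumps of `round` are harmless: stretching only expands, so the `k`-th bump lives in the slab
`|x_{i₀} - k| ≤ 1/4`, away from the half-integers. All local properties of `glue` reduce to a single
cell. -/
lemma glue_eventuallyEq (hD : ∀ k, 1 ≤ D k) {f : Model n → ℝ}
    (hf : tsupport f ⊆ Metric.closedBall 0 (1 / 4)) (c : ℤ → ℝ) (x : Model n) :
    glue i₀ i₁ D f c =ᶠ[𝓝 x]
      fun y ↦ c (round (x i₀)) * f (rescale i₀ i₁ D (round (x i₀)) y) := by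
  have hcont : Continuous fun y : Model n ↦ |y i₀ - round (x i₀)| := by fun_prop
  -- Any bound strictly between `1/2` and `3/4` would do: a point `y` this close to the integer `k`
  -- that rounds to another integer is at distance at least `1/2` from `k` and more than `1/3` from
  -- its own, so both expressions vanish.
  have hx : |x i₀ - round (x i₀)| < 2 / 3 := (abs_sub_round (x i₀)).trans_lt (by norm_num)
  filter_upwards [(isOpen_lt hcont continuous_const).mem_nhds hx] with y hy
  change |y i₀ - round (x i₀)| < 2 / 3 at hy
  rw [glue]
  rcases eq_or_ne (round (y i₀)) (round (x i₀)) with h | h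
  · rw [h]
  have hy' := abs_sub_round (y i₀)
  have hk : (1 : ℝ) ≤ |(round (y i₀) : ℝ) - round (x i₀)| := by
    exact_mod_cast Int.one_le_abs (sub_ne_zero.2 h)
  have h1 := abs_sub_le (round (y i₀) : ℝ) (y i₀) (round (x i₀))
  rw [abs_sub_comm (round (y i₀) : ℝ)  (y i₀)] at h1
  rw [eq_zero_of_abs_sub hD hf (by linarith), eq_zero_of_abs_sub hD hf (by linarith), mul_zero,
    mul_zero]

lemma contDiff_glue (hD : ∀ k, 1 ≤ D k) {f : Model n → ℝ} (hfs : ContDiff ℝ ∞ f)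
    (hf : tsupport f ⊆ Metric.closedBall 0 (1 / 4)) (c : ℤ → ℝ) :
    ContDiff ℝ ∞ (glue i₀ i₁ D f c) :=
  contDiff_iff_contDiffAt.2 fun x ↦ (contDiff_const.mul
    (hfs.comp (contDiff_rescale i₀ i₁ D _))).contDiffAt.congr_of_eventuallyEq
      (glue_eventuallyEq hD hf c x)

/-- Glued functions are closed under differentiation: the chain rule only changes the coefficients
by the stretching factor. -/
lemma partialD_glue (hD : ∀ k, 1 ≤ D k) {f : Model n → ℝ} (hfs : ContDiff ℝ ∞ f)
    (hf : tsupport f ⊆ Metric.closedBall 0 (1 / 4)) (c : ℤ → ℝ) (i : Fin n) :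
    partialD i (glue i₀ i₁ D f c) =
      glue i₀ i₁ D (partialD i f) (fun k ↦ c k * stretch i₀ i₁ D k i) := by
  ext x
  rw [partialD_eq_of_eventuallyEq (glue_eventuallyEq hD hf c x), partialD,
    fderiv_const_mul (a := fun y ↦ f (rescale i₀ i₁ D (round (x i₀)) y))
      ((hfs.comp (contDiff_rescale i₀ i₁ D _)).differentiable (by simp) x)]
  change c _ * partialD i (fun y ↦ f (rescale i₀ i₁ D _ y)) x = _
  rw [partialD_comp_rescale i₀ i₁ D hfs, glue]
  ring

end Glue

/-! ### The cell metric and the Laplacian of the glued function -/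

section

variable (i₀ i₁ : Fin n) (D : ℤ → ℝ) (η : Model n → ℝ)

/-- The conformal factor: `1 + (D k - 1) η` in the `k`-th stretched cell. -/
def conformalFactor (x : Model n) : ℝ := 1 + glue i₀ i₁ D η (fun k ↦ D k - 1) x

variable {i₀ i₁ D η}

lemma one_le_conformalFactor (hD : ∀ k, 1 ≤ D k) (hη : ∀ x, 0 ≤ η x) (x : Model n) :
    1 ≤ conformalFactor i₀ i₁ D η x :=
  le_add_of_nonneg_right (mul_nonneg (sub_nonneg.2 (hD _)) (hη _))

lemma conformalFactor_le (hD : ∀ k, 1 ≤ D k) (hη : ∀ x, η x ≤ 1) (x : Model n) :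
    conformalFactor i₀ i₁ D η x ≤ D (round (x i₀)) := by
  have := mul_le_of_le_one_right (sub_nonneg.2 (hD (round (x i₀))))
    (hη (rescale i₀ i₁ D (round (x i₀)) x))
  rw [conformalFactor, glue]
  linarith

/-- The weight of the metric `a² (dx_{i₀}² + dx_{i₁}²) + ∑ dx_j²` with conformal factor `a`. -/
def cellWeight (hD : ∀ k, 1 ≤ D k) (hη : ContDiff ℝ ∞ η)
    (hηs : tsupport η ⊆ Metric.closedBall 0 (1 / 4)) (hη0 : ∀ x, 0 ≤ η x) (i₀ i₁ : Fin n) :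
    DiagWeight n where
  toFun i x := if i = i₀ ∨ i = i₁ then conformalFactor i₀ i₁ D η x ^ 2 else 1
  contDiff i := by
    split_ifs
    · exact (contDiff_const.add (contDiff_glue hD hη hηs _)).pow 2
    · exact contDiff_const
  one_le i x := by
    split_ifs
    · exact one_le_pow₀ (one_le_conformalFactor hD hη0 x)
    · exact le_rfl

variable {φ : Model n → ℝ} {c : ℤ → ℝ} (hD : ∀ k, 1 ≤ D k)
  (hη : ContDiff ℝ ∞ η) (hηs : tsupport η ⊆ Metric.closedBall 0 (1 / 4)) (hη0 : ∀ x, 0 ≤ η x)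

lemma density_cellWeight (h01 : i₀ ≠ i₁) (x : Model n) :
    (cellWeight hD hη hηs hη0 i₀ i₁).density x = conformalFactor i₀ i₁ D η x ^ 2 := by
  have h : ∏ i, cellWeight hD hη hηs hη0 i₀ i₁ i x = _ := prod_ite_pair h01 _
  rw [DiagWeight.density, h, Real.sqrt_mul_self (sq_nonneg _)]

/-- In the directions `i₀`, `i₁` the factor `√g = a²` cancels `gⁱⁱ = a⁻²`. In the others the flux is
`a² ∂ᵢv`, where either `a = D k` or `∂ᵢφ = 0`. So the transition of `a` leaves no trace and the flux
is again a glued function. -/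
lemma flux_glue (h01 : i₀ ≠ i₁) (hφ : ContDiff ℝ ∞ φ) (hφs : tsupport φ ⊆ Metric.closedBall 0 (1 / 4))
    (h : ∀ x, η x = 1 ∨ ∀ i, i ≠ i₀ → partialD i φ x = 0) (i : Fin n) :
    (cellWeight hD hη hηs hη0 i₀ i₁).flux (glue i₀ i₁ D φ c) i =
      glue i₀ i₁ D (partialD i φ) fun k ↦ c k * (D k * D k) / stretch i₀ i₁ D k i := by
  ext x
  rw [DiagWeight.flux, density_cellWeight hD hη hηs hη0 h01, partialD_glue hD hφ hφs, glue, glue]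
  simp only [cellWeight, stretch]
  have ha := (zero_lt_one.trans_le (one_le_conformalFactor (i₀ := i₀) (i₁ := i₁) hD hη0 x)).ne'
  have hk := (zero_lt_one.trans_le (hD (round (x i₀)))).ne'
  split_ifs with hi
  · field_simp
  · rcases h (rescale i₀ i₁ D (round (x i₀)) x) with h | h
    · have : conformalFactor i₀ i₁ D η x = D (round (x i₀)) := by
        rw [conformalFactor, glue, h]
        ring
      rw [this]
      ring
    · rw [h i (fun h ↦ hi (.inl h))]
      ring

/-- Differentiating the flux restores the missing stretching factor, so every direction carries the
same coefficient `c k * (D k)²`. This matches `√g = a²` because `a = D k` wherever the Euclidean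
Laplacian of `φ` is nonzero. -/
lemma sum_partialD_flux (h01 : i₀ ≠ i₁) (hφ : ContDiff ℝ ∞ φ) (hφs : tsupport φ ⊆ Metric.closedBall 0 (1 / 4))
    (h : ∀ x, η x = 1 ∨ (∀ i, i ≠ i₀ → partialD i φ x = 0) ∧
      ∑ i, partialD i (partialD i φ) x = 0) (x : Model n) :
    (cellWeight hD hη hηs hη0 i₀ i₁).density x *
        glue i₀ i₁ D (fun y ↦ ∑ i, partialD i (partialD i φ) y) c x =
      ∑ i, partialD i ((cellWeight hD hη hηs hη0 i₀ i₁).flux (glue i₀ i₁ D φ c) i) x := by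
  have hs (k : ℤ) (i : Fin n) : stretch i₀ i₁ D k i ≠ 0 := by
    rw [stretch]
    split_ifs
    · exact (zero_lt_one.trans_le (hD k)).ne'
    · exact one_ne_zero
  have hterm (i : Fin n) :
      partialD i ((cellWeight hD hη hηs hη0 i₀ i₁).flux (glue i₀ i₁ D φ c) i) x =
        c (round (x i₀)) * (D (round (x i₀)) * D (round (x i₀))) *
          partialD i (partialD i φ) (rescale i₀ i₁ D (round (x i₀)) x) := by
    rw [flux_glue hD hη hηs hη0 h01 hφ hφs (fun x ↦ (h x).imp_right And.left),
      partialD_glue hD (contDiff_partialD hφ _) ((tsupport_partialD_subset φ _).trans hφs), glue,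
      div_mul_cancel₀ _ (hs _ _)]
  simp only [hterm]
  rw [density_cellWeight hD hη hηs hη0 h01, ← Finset.mul_sum, glue]
  rcases h (rescale i₀ i₁ D (round (x i₀)) x) with h | ⟨-, h⟩
  · have : conformalFactor i₀ i₁ D η x = D (round (x i₀)) := by
      rw [conformalFactor, glue, h]
      ring
    rw [this]
    ring
  · simp [h]

/-! ### `L^p` bounds for glued functions -/

/-- The density is at most `(D k)²` on the `k`-th cell, whose Lebesgue volume is `(D k)⁻²` times
that of a fixed ball, so the stretching drops out and the integral is controlled by `∑ (c k)^p`. -/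
lemma memLp_glue (h01 : i₀ ≠ i₁) (hη1 : ∀ x, η x ≤ 1) {f : Model n → ℝ} (hf : ContDiff ℝ ∞ f)
    (hfs : tsupport f ⊆ Metric.closedBall 0 (1 / 4)) {p : ℝ} (hp : 0 < p) (hc0 : ∀ k, 0 ≤ c k)
    (hc : Summable fun k ↦ c k ^ p) :
    MemLp (glue i₀ i₁ D f c) (ENNReal.ofReal p) (cellWeight hD hη hηs hη0 i₀ i₁).measure := by
  set w := cellWeight hD hη hηs hη0 i₀ i₁
  have hfc : HasCompactSupport f :=
    (isCompact_closedBall 0 _).of_isClosed_subset (isClosed_tsupport f) hfs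
  obtain ⟨C, hC⟩ := hf.continuous.bounded_above_of_compact_support hfc
  have hC0 : 0 ≤ C := (norm_nonneg _).trans (hC 0)
  refine ⟨(contDiff_glue hD hf hfs c).continuous.aestronglyMeasurable, ?_⟩
  rw [eLpNorm_lt_top_iff_lintegral_rpow_enorm_lt_top (by simpa using hp) ENNReal.ofReal_ne_top,
    ENNReal.toReal_ofReal hp.le, DiagWeight.measure, lintegral_withDensity_eq_lintegral_mul _
      w.contDiff_density.continuous.measurable.ennreal_ofReal
      ((contDiff_glue hD hf hfs c).continuous.measurable.enorm.pow_const p)]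
  let S (k : ℤ) : Set (Model n) := rescale i₀ i₁ D k ⁻¹' Metric.closedBall 0 (1 / 4)
  have hS (k : ℤ) : MeasurableSet (S k) :=
    (contDiff_rescale i₀ i₁ D k).continuous.measurable Metric.isClosed_closedBall.measurableSet
  let A (k : ℤ) : ENNReal := ENNReal.ofReal (D k * D k * (c k * C) ^ p)
  have hle (x : Model n) : ((fun x ↦ ENNReal.ofReal (w.density x)) *
      fun x ↦ ‖glue i₀ i₁ D f c x‖ₑ ^ p) x ≤ ∑' k, (S k).indicator (fun _ ↦ A k) x := by
    refine le_trans ?_ (ENNReal.le_tsum (round (x i₀)))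
    rw [Pi.mul_apply]
    by_cases hx : x ∈ S (round (x i₀))
    · rw [Set.indicator_of_mem hx, ← ofReal_norm, ENNReal.ofReal_rpow_of_nonneg (norm_nonneg _) hp.le,
        ← ENNReal.ofReal_mul (w.density_pos x).le]
      refine ENNReal.ofReal_le_ofReal (mul_le_mul ?_ ?_ (by positivity) (mul_self_nonneg _))
      · rw [density_cellWeight hD hη hηs hη0 h01, sq]
        have h1 := one_le_conformalFactor (i₀ := i₀) (i₁ := i₁) hD hη0 x
        have := conformalFactor_le (i₀ := i₀) (i₁ := i₁) hD hη1 x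
        exact mul_self_le_mul_self (by linarith) this
      · refine Real.rpow_le_rpow (norm_nonneg _) ?_ hp.le
        rw [glue, norm_mul, Real.norm_of_nonneg (hc0 _)]
        exact mul_le_mul_of_nonneg_left (hC _) (hc0 _)
    · have : f (rescale i₀ i₁ D (round (x i₀)) x) = 0 := by
        by_contra h
        exact hx (hfs (subset_tsupport f h))
      rw [glue, this, mul_zero, enorm_zero, ENNReal.zero_rpow_of_pos hp, mul_zero]
      exact zero_le
  have hterm (k : ℤ) : ∫⁻ x, (S k).indicator (fun _ ↦ A k) x =
      ENNReal.ofReal (C ^ p * c k ^ p) * volume (Metric.closedBall (0 : Model n) (1 / 4)) := by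
    have hk : 0 < D k * D k := by nlinarith [hD k]
    rw [lintegral_indicator_const (hS k), volume_preimage_rescale h01 hD, ← mul_assoc,
      ← ENNReal.ofReal_mul (by have := hc0 k; positivity), Real.mul_rpow (hc0 k) hC0]
    congr 2
    have := (zero_lt_one.trans_le (hD k)).ne'
    field_simp
  refine (lintegral_mono hle).trans_lt ?_
  rw [lintegral_tsum fun k ↦ (measurable_const.indicator (hS k)).aemeasurable]
  simp only [hterm]
  rw [ENNReal.tsum_mul_right, ← ENNReal.ofReal_tsum_of_nonneg
    (fun k ↦ mul_nonneg (Real.rpow_nonneg hC0 p) (Real.rpow_nonneg (hc0 k) p)) (hc.mul_left _)]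
  exact ENNReal.mul_lt_top ENNReal.ofReal_lt_top measure_closedBall_lt_top

/-! ### Lower bound for weak gradients in the cell centres -/

lemma norm_sub_le_norm_rescale (hD : ∀ k, 1 ≤ D k) (k : ℤ) (x : Model n) :
    ‖x - EuclideanSpace.single i₀ (k : ℝ)‖ ≤ ‖rescale i₀ i₁ D k x‖ := by
  rw [EuclideanSpace.norm_eq, EuclideanSpace.norm_eq]
  refine Real.sqrt_le_sqrt (Finset.sum_le_sum fun i _ ↦ ?_)
  rw [rescale, stretchL_apply, norm_mul]
  have : 1 ≤ ‖stretch i₀ i₁ D k i‖ := by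
    rw [stretch]
    split_ifs
    · exact (hD k).trans (le_abs_self _)
    · simp
  gcongr
  exact le_mul_of_one_le_left (norm_nonneg _) this

lemma round_eq_of_rescale_mem (hD : ∀ k, 1 ≤ D k) {k : ℤ} {x : Model n}
    (hx : rescale i₀ i₁ D k x ∈ Metric.ball (0 : Model n) (1 / 16)) : round (x i₀) = k := by
  have h := (abs_sub_le_norm_rescale hD k x).trans_lt (mem_ball_zero_iff.1 hx)
  rw [abs_lt] at h
  rw [round_eq, Int.floor_eq_iff]
  constructor <;> linarith

/-- The test field concentrated in the `k`-th cell. -/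
def cellField (i₀ i₁ : Fin n) (D : ℤ → ℝ) (ρ : Model n → ℝ) (k : ℤ) (x : Model n) : Model n :=
  ρ (rescale i₀ i₁ D k x) • EuclideanSpace.single i₀ (1 : ℝ)

lemma cellField_apply (ρ : Model n → ℝ) (k : ℤ) (x : Model n) (i : Fin n) :
    cellField i₀ i₁ D ρ k x i = if i = i₀ then ρ (rescale i₀ i₁ D k x) else 0 := by
  simp [cellField, PiLp.single_apply]

/-- At the centre of a cell the metric is Euclidean and `∂_{i₀} v = c k * D k`. Pairing with a
unit-size field there gives the left side up to a constant; Hölder on a set of volume comparable to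
`(D k)⁻²` gives the right side, with `C` independent of `k`. -/
lemma exists_le_of_memW1 (h01 : i₀ ≠ i₁) (hφ : ContDiff ℝ ∞ φ)
    (hφs : tsupport φ ⊆ Metric.closedBall 0 (1 / 4))
    (h : ∀ x ∈ Metric.ball (0 : Model n) (1 / 16),
      η x = 0 ∧ ∀ i, partialD i φ x = if i₀ = i then 1 else 0) {p : ℝ} (hp : 1 ≤ p)
    (hc0 : ∀ k, 0 ≤ c k)
    (hW : MemW1 n (M := DiagSpace (cellWeight hD hη hηs hη0 i₀ i₁)) (glue i₀ i₁ D φ c)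
      (ENNReal.ofReal p)) :
    ∃ C : ℝ, ∀ k, c k * D k * (D k * D k)⁻¹ ≤ C * ((D k * D k)⁻¹) ^ (1 - 1 / p) := by
  set w := cellWeight hD hη hηs hη0 i₀ i₁ with hw
  obtain ⟨-, X, hX, hXp⟩ := hW
  -- The support stays in the ball of radius `1/16` where `η = 0`, so the Riemannian norm of the
  -- test field is its Euclidean one.
  let χ : ContDiffBump (0 : Model n) := ⟨1 / 32, 1 / 16, by norm_num, by norm_num⟩
  set V := volume (Metric.ball (0 : Model n) (1 / 16)) with hV
  set V' := volume (Metric.ball (0 : Model n) (1 / 32)) with hV'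
  have hVfin : V ≠ ⊤ := measure_ball_lt_top.ne
  have hV'fin : V' ≠ ⊤ := measure_ball_lt_top.ne
  have hV'pos : 0 < V'.toReal :=
    ENNReal.toReal_pos (Metric.measure_ball_pos _ _ (by norm_num)).ne' hV'fin
  set N := (eLpNorm (fun x ↦ ‖X x‖) (ENNReal.ofReal p)
    (riemannianVolume n (DiagSpace w))).toReal
  refine ⟨N * V.toReal ^ (1 - 1 / p) / V'.toReal, fun k ↦ ?_⟩
  have hDk : 0 < D k := zero_lt_one.trans_le (hD k)
  let S : Set (Model n) := rescale i₀ i₁ D k ⁻¹' Metric.ball 0 (1 / 16)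
  have hSm : MeasurableSet S :=
    (contDiff_rescale i₀ i₁ D k).continuous.measurable Metric.isOpen_ball.measurableSet
  have hconf (x : Model n) (hx : x ∈ S) : conformalFactor i₀ i₁ D η x = 1 := by
    rw [conformalFactor, glue, round_eq_of_rescale_mem hD hx, (h _ hx).1, mul_zero, add_zero]
  have hdens (x : Model n) (hx : x ∈ S) : w.density x = 1 := by
    rw [hw, density_cellWeight hD hη hηs hη0 h01, hconf x hx, one_pow]
  have hρ0 (x : Model n) (hx : x ∉ S) : χ (rescale i₀ i₁ D k x) = 0 := by
    rw [← Function.notMem_support, χ.support_eq]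
    exact hx
  have hSvol : riemannianVolume n (DiagSpace w) S = ENNReal.ofReal (D k * D k)⁻¹ * V := by
    rw [DiagSpace.riemannianVolume_eq, ← volume_preimage_rescale h01 hD]
    refine (withDensity_apply _ hSm).trans ?_
    rw [setLIntegral_congr_fun hSm (g := fun _ ↦ 1) fun x hx ↦ by simp [hdens x hx]]
    simp [S]
  let Y : ∀ x : DiagSpace w, TangentSpace (𝓡 n) x :=
    cellField i₀ i₁ D χ k
  have hρs : ContDiff ℝ ∞ fun x ↦ χ (rescale i₀ i₁ D k x) :=
    χ.contDiff.comp (contDiff_rescale i₀ i₁ D k)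
  have hρc : HasCompactSupport fun x ↦ χ (rescale i₀ i₁ D k x) := by
    refine HasCompactSupport.of_support_subset_isCompact
      (isCompact_closedBall (EuclideanSpace.single i₀ (k : ℝ) : Model n) (1 / 16)) fun x hx ↦ ?_
    by_contra hx'
    refine hx (hρ0 x fun hxS ↦ hx' ?_)
    rw [Metric.mem_closedBall, dist_eq_norm]
    exact (norm_sub_le_norm_rescale (i₁ := i₁) hD k x).trans (mem_ball_zero_iff.1 hxS).le
  have hY : IsTestField Y := (DiagSpace.isTestField_iff w Y).2
    ⟨hρs.smul contDiff_const, hρc.smul_right⟩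
  have hYS (x : DiagSpace w) (hx : x ∉ S) : Y x = 0 := by
    change χ (rescale i₀ i₁ D k x) • EuclideanSpace.single i₀ (1 : ℝ) = 0
    rw [hρ0 x hx, zero_smul]
  have hY1 (x : DiagSpace w) : ‖Y x‖ ≤ 1 := by
    by_cases hx : x ∈ S
    · have h1 : ‖Y x‖ ^ 2 = w i₀ x * (χ (rescale i₀ i₁ D k x) * χ (rescale i₀ i₁ D k x)) := by
        have hform (x : Model n) : w.form x (cellField i₀ i₁ D χ k x) (cellField i₀ i₁ D χ k x) =
            w i₀ x * (χ (rescale i₀ i₁ D k x) * χ (rescale i₀ i₁ D k x)) := by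
          rw [w.form_apply]
          simp [cellField_apply]
        exact (DiagSpace.norm_sq_eq w x (Y x)).trans (hform x)
      have h2 : w i₀ x = 1 := by
        have : w i₀ x = conformalFactor i₀ i₁ D η x ^ 2 := if_pos (.inl rfl)
        rw [this, hconf x hx, one_pow]
      rw [h2, one_mul] at h1
      refine (sq_le_one_iff₀ (norm_nonneg _)).1 (h1.trans_le ?_)
      exact mul_le_one₀ χ.le_one χ.nonneg χ.le_one
    · rw [hYS x hx, norm_zero]
      exact zero_le_one
  have key := DiagSpace.integral_inner_grad_le w (contDiff_glue hD hφ hφs c) hX hp hXp hY hY1 hYS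
    (by rw [hSvol]; exact ENNReal.mul_ne_top ENNReal.ofReal_ne_top hVfin)
  have hint : ∫ x : Model n, w.density x * ∑ i, partialD i (glue i₀ i₁ D φ c) x *
      DiagSpace.coord w Y x i = c k * D k * ∫ x, χ (rescale i₀ i₁ D k x) := by
    rw [← integral_const_mul]
    congr with x
    have hsum : ∑ i, partialD i (glue i₀ i₁ D φ c) x * DiagSpace.coord w Y x i =
        partialD i₀ (glue i₀ i₁ D φ c) x * χ (rescale i₀ i₁ D k x) := by
      change ∑ i, partialD i (glue i₀ i₁ D φ c) x * cellField i₀ i₁ D χ k x i = _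
      simp [cellField_apply]
    rw [hsum]
    by_cases hx : x ∈ S
    · rw [hdens x hx, partialD_glue hD hφ hφs, glue, round_eq_of_rescale_mem hD hx, (h _ hx).2,
        if_pos rfl, stretch, if_pos (.inl rfl)]
      ring
    · rw [hρ0 x hx]
      ring
  have hlow : (D k * D k)⁻¹ * V'.toReal ≤ ∫ x, χ (rescale i₀ i₁ D k x) := by
    let S' : Set (Model n) := rescale i₀ i₁ D k ⁻¹' Metric.ball 0 (1 / 32)
    have hS'm : MeasurableSet S' :=
      (contDiff_rescale i₀ i₁ D k).continuous.measurable Metric.isOpen_ball.measurableSet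
    have hS'vol : volume S' = ENNReal.ofReal (D k * D k)⁻¹ * V' :=
      volume_preimage_rescale h01 hD k _
    have hreal : (D k * D k)⁻¹ * V'.toReal = ∫ x, S'.indicator (fun _ ↦ (1 : ℝ)) x := by
      rw [integral_indicator hS'm, setIntegral_const, Measure.real, hS'vol, ENNReal.toReal_mul,
        ENNReal.toReal_ofReal (by positivity), smul_eq_mul, mul_one]
    rw [hreal]
    refine integral_mono ((integrable_indicator_iff hS'm).2 (integrableOn_const (by
      rw [hS'vol]; exact ENNReal.mul_ne_top ENNReal.ofReal_ne_top hV'fin)))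
      (hρs.continuous.integrable_of_hasCompactSupport hρc) fun x ↦ ?_
    by_cases hx : x ∈ S'
    · rw [Set.indicator_of_mem hx]
      exact (χ.one_of_mem_closedBall (Metric.ball_subset_closedBall hx)).ge
    · rw [Set.indicator_of_notMem hx]
      exact χ.nonneg
  rw [hint, hSvol, ENNReal.toReal_mul, ENNReal.toReal_ofReal (by positivity),
    Real.mul_rpow (by positivity) ENNReal.toReal_nonneg] at key
  have h1 := (mul_le_mul_of_nonneg_left hlow (mul_nonneg (hc0 k) hDk.le)).trans key
  rw [div_mul_eq_mul_div, le_div_iff₀ hV'pos]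
  linarith

end

/-! ### Choice of the parameters and conclusion -/

lemma summable_exp_neg_abs {p : ℝ} (hp : 0 < p) :
    Summable fun k : ℤ ↦ Real.exp (-|(k : ℝ)|) ^ p := by
  have h : Summable fun m : ℕ ↦ Real.exp (m * -p) :=
    Real.summable_exp_nat_mul_iff.2 (neg_lt_zero.2 hp)
  have he (m : ℕ) : Real.exp (-(m : ℝ)) ^ p = Real.exp (m * -p) := by
    rw [← Real.exp_mul]
    ring_nf
  refine Summable.of_nat_of_neg ?_ ?_ <;> simpa [he] using h

lemma exists_weight {n : ℕ} (hn : 2 ≤ n) {p : ℝ} (hp : 2 < p) :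
    ∃ (w : DiagWeight n) (v : Model n → ℝ),
      MemH2 n (M := DiagSpace w) v (ENNReal.ofReal p) ∧
      (∃ X : (∀ x : DiagSpace w, TangentSpace (𝓡 n) x),
        IsWeakGradient (M := DiagSpace w) v X) ∧
      ¬ MemW1 n (M := DiagSpace w) v (ENNReal.ofReal p) := by
  let i₀ : Fin n := ⟨0, by omega⟩
  let i₁ : Fin n := ⟨1, by omega⟩
  have h01 : i₀ ≠ i₁ := by simp [i₀, i₁]
  obtain ⟨φ, η, hφ, hη, hφs, hηs, hη0, hη1, hin, hout⟩ := exists_profile i₀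
  have hp0 : 0 < p := by linarith
  have hp2 : 0 < p - 2 := by linarith
  -- Chosen so that `β (1 - 2/p) = 2`: then `c k * (D k)^(1 - 2/p) = exp |k|`, which is unbounded
  -- although `c k` decays.
  let β : ℝ := 2 * p / (p - 2)
  have hβ : 0 < β := by positivity
  let D (k : ℤ) : ℝ := Real.exp (β * |(k : ℝ)|)
  let c (k : ℤ) : ℝ := Real.exp (-|(k : ℝ)|)
  have hD (k : ℤ) : 1 ≤ D k := Real.one_le_exp (by positivity)
  have hc0 (k : ℤ) : 0 ≤ c k := (Real.exp_pos _).le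
  have hc : Summable fun k ↦ c k ^ p := summable_exp_neg_abs hp0
  let L (y : Model n) : ℝ := ∑ i, partialD i (partialD i φ) y
  have hL : ContDiff ℝ ∞ L := ContDiff.sum fun i _ ↦ contDiff_partialD (contDiff_partialD hφ i) i
  have hLs : tsupport L ⊆ Metric.closedBall 0 (1 / 4) := by
    refine closure_minimal (fun y hy ↦ ?_) Metric.isClosed_closedBall
    obtain ⟨i, -, hi⟩ := Finset.exists_ne_zero_of_sum_ne_zero (Function.mem_support.1 hy)
    exact hφs (tsupport_partialD_subset φ i (tsupport_partialD_subset _ i (subset_tsupport _ hi)))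
  set w := cellWeight hD hη hηs hη0 i₀ i₁
  have hvs := contDiff_glue (i₀ := i₀) (i₁ := i₁) hD hφ hφs c
  have hvol := DiagSpace.riemannianVolume_eq w
  refine ⟨w, glue i₀ i₁ D φ c, ⟨?_, glue i₀ i₁ D L c, ?_, ?_⟩,
    ⟨_, DiagSpace.isWeakGradient_grad w hvs⟩, fun hW ↦ ?_⟩
  · rw [hvol]
    exact memLp_glue hD hη hηs hη0 h01 hη1 hφ hφs hp0 hc0 hc
  · rw [hvol]
    exact memLp_glue hD hη hηs hη0 h01 hη1 hL hLs hp0 hc0 hc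
  · exact DiagSpace.isDistribLaplacian w hvs (contDiff_glue hD hL hLs c).continuous
      (sum_partialD_flux hD hη hηs hη0 h01 hφ hφs hout)
  · obtain ⟨C, hC⟩ := exists_le_of_memW1 hD hη hηs hη0 h01 hφ hφs hin (by linarith) hc0 hW
    have hbound (k : ℕ) : (k : ℝ) < C := by
      have h := hC k
      simp only [c, D, ← Real.exp_add, ← Real.exp_neg, ← Real.exp_mul, Int.cast_natCast,
        Nat.abs_cast] at h
      rw [← div_le_iff₀ (Real.exp_pos _), ← Real.exp_sub] at h
      have he : -(k : ℝ) + β * k + -(β * k + β * k) - -(β * k + β * k) * (1 - 1 / p) = k := by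
        simp only [β]
        field_simp
        ring
      rw [he] at h
      linarith [Real.add_one_le_exp (k : ℝ)]
    obtain ⟨k, hk⟩ := exists_nat_gt C
    linarith [hbound k]

end RiemannianSobolev

end

open scoped Manifold ContDiff Bundle in
theorem mainTheorem11 (n : ℕ) (hn : 2 ≤ n) (p : ℝ) (hp : 2 < p) :
    ∃ (M : Type) (_ : EMetricSpace M) (_ : ChartedSpace (EuclideanSpace ℝ (Fin n)) M)
      (_ : IsManifold (𝓡 n) ∞ M)
      (_ : Bundle.RiemannianBundle (fun x : M ↦ TangentSpace (𝓡 n) x))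
      (_ : IsContMDiffRiemannianBundle (𝓡 n) ∞ (EuclideanSpace ℝ (Fin n))
        (fun x : M ↦ TangentSpace (𝓡 n) x))
      (_ : IsRiemannianManifold (𝓡 n) M)
      (_ : MeasurableSpace M) (_ : BorelSpace M),
      ConnectedSpace M ∧ SecondCountableTopology M ∧ CompleteSpace M ∧ NoncompactSpace M ∧
      ∃ v : M → ℝ,
        RiemannianSobolev.MemH2 n v (ENNReal.ofReal p) ∧
        (∃ X : (∀ x : M, TangentSpace (𝓡 n) x),
          RiemannianSobolev.IsWeakGradient v X ∧
          ¬ MeasureTheory.MemLp (fun x ↦ ‖X x‖) (ENNReal.ofReal p)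
            (RiemannianSobolev.riemannianVolume n M)) ∧
        ¬ RiemannianSobolev.MemW1 n v (ENNReal.ofReal p) := by
  obtain ⟨w, v, hv, ⟨X, hX⟩, hW⟩ := RiemannianSobolev.exists_weight hn hp
  have : NeZero n := ⟨by omega⟩
  exact ⟨RiemannianSobolev.DiagSpace w, inferInstance,
    RiemannianSobolev.DiagSpace.instChartedSpaceModel w, inferInstance, inferInstance, inferInstance,
    inferInstance, inferInstance, inferInstance, inferInstance, inferInstance, inferInstance,
    RiemannianSobolev.DiagSpace.noncompactSpace w, v, hv,
    -- An `L^p` bound on this particular weak gradient would already put `v` in `W^{1,p}`.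
    ⟨X, hX, fun h ↦ hW ⟨hv.1, X, hX, h⟩⟩, hW⟩
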